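/- For $k\ge 1$ let $\ln_k x=\sum_{m\ge 1}x^m/m^k$ ($|x|<1$) be the $k$-th polylogarithm, and let $\log$ be the principal branch of the logarithm. For $n\ge 0$ let $\Lambda(x)$ be the upper triangular $(n+1)\times(n+1)$ matrix, with rows and columns numbered $0,\dots,n$, whose entries on the disk $|x-1/2|<1/2$ are $$\Lambda_{00}=1,\qquad \Lambda_{0k}(x)=\ln_k x\ (k\ge 1),\qquad \Lambda_{jk}(x)=\frac{(2\pi i)^j}{(k-j)!}\log^{k-j}x\ (1\le j\le k),\qquad \Lambda_{jk}=0\ (k<j).$$ There is a unique homomorphism $M:\pi_1(\mathbb C-\{0,1\},1/2)\to GL_{n+1}(\mathbb C)$ (the monodromy representation; in $\pi_1$ the product $\alpha\beta$ traverses $\alpha$ first) such that, for every loop $\gamma$ in $\mathbb C-\{0,1\}$ based at $1/2$, the analytic continuation of $\Lambda(x)$ along $\gamma$ exists and is $M(\gamma)\Lambda(x)$. For the loops $\sigma_0(t)=e^{2\pi it}/2$ and $\sigma_1(t)=1-e^{2\pi it}/2$, $0\le t\le 1$, it satisfies $$M(\sigma_0)=\begin{pmatrix}1&0\\0&J\end{pmatrix},\qquad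 J=\exp(N),$$ where $N$ is the $n\times n$ matrix with $N_{i,i+1}=1$ and all other entries $0$, and $M(\sigma_1)$ is the identity matrix with an additional entry $-1$ in position $(0,1)$ (for $n=0$, the identity matrix). Moreover, for every $k\ge 1$ the analytic continuation of $\ln_k x$ along $\sigma_1$ is $$\ln_k x-\frac{2\pi i}{(k-1)!}\log^{k-1}x.$$ -/

import Mathlib

open Filter Topology

noncomputable section

namespace Polylog

/-- The `k`-th polylogarithm `ln_k x = ∑_{m ≥ 1} x ^ m / m ^ k`, given by its power series. The
series converges for `‖x‖ < 1`, and only its values there are ever used. -/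
def polylog (k : ℕ) (x : ℂ) : ℂ := ∑' m : ℕ, x ^ (m + 1) / ((m : ℂ) + 1) ^ k

/-- The principal branch, on the disk `|x - 1/2| < 1/2`, of the upper triangular
`(n+1) × (n+1)` matrix `Λ(x)`, with rows and columns numbered `0, …, n`. -/
def fundMatrix (n : ℕ) (x : ℂ) : Matrix (Fin (n + 1)) (Fin (n + 1)) ℂ :=
  Matrix.of fun j k =>
    if (k : ℕ) < j then 0
    else if (j : ℕ) = 0 then (if (k : ℕ) = 0 then 1 else polylog k x)
    else (2 * (Real.pi : ℂ) * Complex.I) ^ (j : ℕ) / (((k : ℕ) - (j : ℕ)).factorial : ℂ)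
      * Complex.log x ^ ((k : ℕ) - (j : ℕ))

/-- The space `ℂ - {0, 1}`. -/
abbrev PuncturedPlane : Type := {z : ℂ // z ≠ 0 ∧ z ≠ 1}

/-- The base point `1/2`. -/
def base : PuncturedPlane := ⟨1 / 2, by norm_num, by norm_num⟩

/-- `g` is the analytic continuation of `f` along the path `γ` in `ℂ - {0, 1}`: there are germs of
holomorphic functions `F t` at the points `γ t`, locally coherent in `t`, that begin with the germ
of `f` at the starting point of `γ` and end with the germ of `g` at its end point. -/
def IsAnalyticContinuation {a b : PuncturedPlane} (f : ℂ → ℂ) (γ : Path a b) (g : ℂ → ℂ) : Prop :=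
  ∃ F : unitInterval → ℂ → ℂ,
    (∀ t, AnalyticAt ℂ (F t) (γ t : ℂ)) ∧
    (∀ t, ∀ᶠ s in 𝓝 t, F s =ᶠ[𝓝 (γ s : ℂ)] F t) ∧
    F 0 =ᶠ[𝓝 (a : ℂ)] f ∧
    F 1 =ᶠ[𝓝 (b : ℂ)] g

/-- Analytic continuation of a matrix of functions, entry by entry. -/
def IsMatrixContinuation {ι : Type} {a b : PuncturedPlane} (f : ℂ → Matrix ι ι ℂ) (γ : Path a b)
    (g : ℂ → Matrix ι ι ℂ) : Prop :=
  ∀ i j, IsAnalyticContinuation (fun x => f x i j) γ (fun x => g x i j)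

/-- The class in `π₁(ℂ - {0, 1}, 1/2)` of a loop. Mathlib's product `p * q` in `FundamentalGroup`
traverses `q` first; in the opposite group, used here, the product `α β` traverses `α` first. -/
def loopClass (γ : Path base base) : (FundamentalGroup PuncturedPlane base)ᵐᵒᵖ :=
  MulOpposite.op (FundamentalGroup.fromPath (Path.Homotopic.Quotient.mk γ))

/-- `M` is the monodromy representation of `Λ`: the analytic continuation of the principal branch
of `Λ(x)` about each loop `γ` based at `1/2` is `M(γ) Λ(x)`. -/
def IsMonodromyRepresentation (n : ℕ)
    (M : (FundamentalGroup PuncturedPlane base)ᵐᵒᵖ →* GL (Fin (n + 1)) ℂ) : Prop :=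
  ∀ γ : Path base base, IsMatrixContinuation (fundMatrix n) γ
    (fun x => (M (loopClass γ) : Matrix (Fin (n + 1)) (Fin (n + 1)) ℂ) * fundMatrix n x)

/-- A point of the form `exp (2πit) / 2`. -/
def circlePoint (t : ℝ) : ℂ := Complex.exp (2 * (Real.pi : ℂ) * Complex.I * (t : ℂ)) / 2

theorem norm_circlePoint (t : ℝ) : ‖circlePoint t‖ = 1 / 2 := by
  have h : 2 * (Real.pi : ℂ) * Complex.I * (t : ℂ) = ((2 * Real.pi * t : ℝ) : ℂ) * Complex.I := by
    push_cast; ring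
  rw [circlePoint, norm_div, h, Complex.norm_exp_ofReal_mul_I]
  norm_num

theorem circlePoint_ne_zero (t : ℝ) : circlePoint t ≠ 0 := by
  intro h
  have := norm_circlePoint t
  rw [h] at this
  norm_num at this

theorem circlePoint_ne_one (t : ℝ) : circlePoint t ≠ 1 := by
  intro h
  have := norm_circlePoint t
  rw [h] at this
  norm_num at this

theorem circlePoint_zero : circlePoint 0 = 1 / 2 := by simp [circlePoint]

theorem circlePoint_one : circlePoint 1 = 1 / 2 := by simp [circlePoint, Complex.exp_two_pi_mul_I]

theorem continuous_circlePoint : Continuous circlePoint := by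
  unfold circlePoint; fun_prop

/-- The loop `σ₀(t) = exp (2πit) / 2`. -/
def sigma0 : Path base base where
  toFun t := ⟨circlePoint t, circlePoint_ne_zero t, circlePoint_ne_one t⟩
  continuous_toFun := (continuous_circlePoint.comp continuous_subtype_val).subtype_mk _
  source' := Subtype.ext (by simp [base, circlePoint_zero])
  target' := Subtype.ext (by simp [base, circlePoint_one])

/-- The loop `σ₁(t) = 1 - exp (2πit) / 2`. -/
def sigma1 : Path base base where
  toFun t := ⟨1 - circlePoint t, sub_ne_zero.mpr (circlePoint_ne_one t).symm,
    fun h => circlePoint_ne_zero t (by linear_combination -h)⟩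
  continuous_toFun :=
    (continuous_const.sub (continuous_circlePoint.comp continuous_subtype_val)).subtype_mk _
  source' := Subtype.ext (by norm_num [base, circlePoint_zero])
  target' := Subtype.ext (by norm_num [base, circlePoint_one])

/-- The `n × n` nilpotent matrix with `1` directly above the diagonal and `0` elsewhere. -/
def shift (n : ℕ) : Matrix (Fin n) (Fin n) ℂ :=
  Matrix.of fun i j => if (j : ℕ) = i + 1 then 1 else 0

/-- The block diagonal matrix `diag(1, J)`, with `J` of size `n × n`. -/
def blockOne {n : ℕ} (J : Matrix (Fin n) (Fin n) ℂ) : Matrix (Fin (n + 1)) (Fin (n + 1)) ℂ :=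
  Matrix.of (Fin.cons (Fin.cons 1 fun _ => 0) fun i => Fin.cons 0 (J i))

/-- The identity matrix with an additional entry `-1` in position `(0, 1)` (when `n ≥ 1`). -/
def unipotentOne (n : ℕ) : Matrix (Fin (n + 1)) (Fin (n + 1)) ℂ :=
  Matrix.of fun i j => if i = j then 1 else if (i : ℕ) = 0 ∧ (j : ℕ) = 1 then -1 else 0

end Polylog

end

/-! The entries of `Λ` satisfy a linear system `Y' = Y A` whose coefficients are holomorphic off `0`
and `1`: each column has as derivative the preceding column times `1/(1-x)` or `1/x`. Constant
matrices act on solutions from the left, and on a disk omitting `0` and `1` every solution is a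
constant times one invertible solution. The values of solutions therefore form a covering space of
the punctured plane (`isCoveringMap_solutionCore`). Lifting paths to it is analytic continuation
(`isMatrixContinuation_of_lift`), so homotopy invariance and multiplicativity come from the
monodromy of a covering. Since `Λ(1/2)` is invertible, every value over the base point is `C Λ(1/2)`
for a unique `C`, which gives the matrices `M(γ)`.

Analytic continuation along a path is unique (`IsAnalyticContinuation.unique`), so `M` is unique,
and its value on a loop is found by exhibiting any continuation of `Λ` along that loop. Around `0`
the polylogarithms are unchanged and `log` gains `2πi`; the binomial theorem turns this into
multiplication by `exp N`. Around `1`, `log` is unchanged, and `exists_polylog_eq_regular_sub`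
isolates the singular part `-log^{k-1} x log(1-x)/(k-1)!` of `ln_k`, where only `log(1-x)` changes,
again by `2πi`. -/

noncomputable section

namespace Polylog

/-! ### Analytic continuation along a path: uniqueness and algebra. -/

namespace IsAnalyticContinuation

variable {a b : PuncturedPlane} {γ : Path a b} {f f₁ f₂ g g₁ g₂ : ℂ → ℂ}

theorem tendsto_path (γ : Path a b) (t : unitInterval) :
    Tendsto (fun s => (γ s : ℂ)) (𝓝 t) (𝓝 (γ t : ℂ)) :=
  (continuous_subtype_val.comp γ.continuous).tendsto t

/-- Two holomorphic germs are either equal, or differ at all nearby points. -/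
theorem eventually_germ_iff {F G : ℂ → ℂ} {z : ℂ} (hF : AnalyticAt ℂ F z) (hG : AnalyticAt ℂ G z) :
    ∀ᶠ w in 𝓝 z, (F =ᶠ[𝓝 w] G ↔ F =ᶠ[𝓝 z] G) := by
  rcases hF.eventually_eq_or_eventually_ne hG with h | h
  · filter_upwards [eventually_eventually_nhds.mpr h] with w hw
    exact ⟨fun _ => h, fun _ => hw⟩
  · have hne : ¬ F =ᶠ[𝓝 z] G := fun h' => by
      obtain ⟨w, hw, hw'⟩ := (h.and (h'.filter_mono nhdsWithin_le_nhds)).exists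
      exact hw hw'
    rw [eventually_nhdsWithin_iff] at h
    filter_upwards [h] with w hw
    refine ⟨fun h' => ?_, fun h' => absurd h' hne⟩
    by_cases hwz : w = z
    · rwa [hwz] at h'
    · exact absurd h'.self_of_nhds (hw hwz)

/-- Analytic continuation along a path is unique. -/
theorem unique (h₁ : IsAnalyticContinuation f₁ γ g₁) (h₂ : IsAnalyticContinuation f₂ γ g₂)
    (hf : f₁ =ᶠ[𝓝 (a : ℂ)] f₂) : g₁ =ᶠ[𝓝 (b : ℂ)] g₂ := by
  obtain ⟨F, hFa, hFc, hF0, hF1⟩ := h₁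
  obtain ⟨G, hGa, hGc, hG0, hG1⟩ := h₂
  -- Whether the two germs agree is a locally constant property of `t`, so on the connected interval
  -- it is decided at `0`.
  have key : ∀ t, ∀ᶠ s in 𝓝 t, (F s =ᶠ[𝓝 (γ s : ℂ)] G s ↔ F t =ᶠ[𝓝 (γ t : ℂ)] G t) := by
    intro t
    filter_upwards [hFc t, hGc t,
      (tendsto_path γ t).eventually (eventually_germ_iff (hFa t) (hGa t))] with s hs hs' h
    exact ⟨fun e => h.mp (hs.symm.trans (e.trans hs')), fun e => hs.trans ((h.mpr e).trans hs'.symm)⟩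
  have hcl : IsClopen {t | F t =ᶠ[𝓝 (γ t : ℂ)] G t} := by
    refine ⟨⟨isOpen_iff_mem_nhds.mpr fun t ht => ?_⟩, isOpen_iff_mem_nhds.mpr fun t ht => ?_⟩
    · filter_upwards [key t] with s hs using fun h => ht (hs.mp h)
    · filter_upwards [key t] with s hs using hs.mpr ht
  have hall := hcl.eq_univ ⟨0, by
    have : F 0 =ᶠ[𝓝 (a : ℂ)] G 0 := hF0.trans (hf.trans hG0.symm)
    simpa using this⟩
  have h1 : F 1 =ᶠ[𝓝 (γ 1 : ℂ)] G 1 := by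
    have : (1 : unitInterval) ∈ {t | F t =ᶠ[𝓝 (γ t : ℂ)] G t} := hall ▸ Set.mem_univ _
    exact this
  rw [γ.target] at h1
  exact hF1.symm.trans (h1.trans hG1)

theorem congr (h : IsAnalyticContinuation f₁ γ g₁) (hf : f₁ =ᶠ[𝓝 (a : ℂ)] f₂)
    (hg : g₁ =ᶠ[𝓝 (b : ℂ)] g₂) : IsAnalyticContinuation f₂ γ g₂ := by
  obtain ⟨F, hFa, hFc, hF0, hF1⟩ := h
  exact ⟨F, hFa, hFc, hF0.trans hf, hF1.trans hg⟩

/-- A function that is holomorphic along the whole path continues to itself. -/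
theorem of_analyticAt (h : ∀ t, AnalyticAt ℂ f (γ t : ℂ)) : IsAnalyticContinuation f γ f :=
  ⟨fun _ => f, h, fun _ => Eventually.of_forall fun _ => EventuallyEq.rfl, EventuallyEq.rfl,
    EventuallyEq.rfl⟩

theorem const (c : ℂ) : IsAnalyticContinuation (fun _ => c) γ (fun _ => c) :=
  of_analyticAt fun _ => analyticAt_const

theorem add (h₁ : IsAnalyticContinuation f₁ γ g₁) (h₂ : IsAnalyticContinuation f₂ γ g₂) :
    IsAnalyticContinuation (fun x => f₁ x + f₂ x) γ (fun x => g₁ x + g₂ x) := by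
  obtain ⟨F, hFa, hFc, hF0, hF1⟩ := h₁
  obtain ⟨G, hGa, hGc, hG0, hG1⟩ := h₂
  refine ⟨fun t x => F t x + G t x, fun t => (hFa t).add (hGa t), fun t => ?_, hF0.add hG0,
    hF1.add hG1⟩
  filter_upwards [hFc t, hGc t] with s hs hs' using hs.add hs'

theorem mul (h₁ : IsAnalyticContinuation f₁ γ g₁) (h₂ : IsAnalyticContinuation f₂ γ g₂) :
    IsAnalyticContinuation (fun x => f₁ x * f₂ x) γ (fun x => g₁ x * g₂ x) := by
  obtain ⟨F, hFa, hFc, hF0, hF1⟩ := h₁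
  obtain ⟨G, hGa, hGc, hG0, hG1⟩ := h₂
  refine ⟨fun t x => F t x * G t x, fun t => (hFa t).mul (hGa t), fun t => ?_, hF0.mul hG0,
    hF1.mul hG1⟩
  filter_upwards [hFc t, hGc t] with s hs hs' using hs.mul hs'

theorem const_mul (c : ℂ) (h : IsAnalyticContinuation f γ g) :
    IsAnalyticContinuation (fun x => c * f x) γ (fun x => c * g x) :=
  (const c).mul h

theorem pow (h : IsAnalyticContinuation f γ g) (m : ℕ) :
    IsAnalyticContinuation (fun x => f x ^ m) γ (fun x => g x ^ m) := by
  induction m with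
  | zero => simpa using const 1
  | succ m ih => simpa only [pow_succ] using ih.mul h

end IsAnalyticContinuation

/-! ### Derivatives of the polylogarithms and their singularity at `1`. -/

theorem norm_natCast_add_one_pow_ge (m k : ℕ) : 1 ≤ ‖((m : ℂ) + 1) ^ k‖ := by
  rw [norm_pow]
  refine one_le_pow₀ ?_
  rw [← Nat.cast_succ, Complex.norm_natCast]
  exact_mod_cast Nat.succ_pos m

/-- Termwise differentiation of the series of the polylogarithm. -/
theorem hasDerivAt_polylog_tsum (k : ℕ) {x : ℂ} (hx : ‖x‖ < 1) :
    HasDerivAt (polylog (k + 1)) (∑' m : ℕ, x ^ m / ((m : ℂ) + 1) ^ k) x := by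
  obtain ⟨r, hxr, hr⟩ := exists_between hx
  have hr0 : 0 ≤ r := (norm_nonneg x).trans hxr.le
  change HasDerivAt (fun z => ∑' m : ℕ, z ^ (m + 1) / ((m : ℂ) + 1) ^ (k + 1)) _ x
  refine hasDerivAt_tsum_of_isPreconnected (u := fun m : ℕ => r ^ m) (t := Metric.ball (0 : ℂ) r) (y₀ := 0)
    (g' := fun m y => y ^ m / ((m : ℂ) + 1) ^ k)
    (summable_geometric_of_lt_one hr0 hr) Metric.isOpen_ball
    (convex_ball _ _).isPreconnected (fun m y _ => ?_) (fun m y hy => ?_)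
    (Metric.mem_ball_self ((norm_nonneg x).trans_lt hxr)) ?_
    (mem_ball_zero_iff.mpr hxr)
  · have hm : ((m : ℂ) + 1) ≠ 0 := Nat.cast_add_one_ne_zero m
    have h := (hasDerivAt_pow (m + 1) y).div_const (((m : ℂ) + 1) ^ (k + 1))
    refine h.congr_deriv ?_
    push_cast
    field_simp
    ring
  · rw [norm_div, norm_pow]
    have hy' : ‖y‖ ≤ r := by simpa using (Metric.mem_ball.mp hy).le
    exact (div_le_self (by positivity) (norm_natCast_add_one_pow_ge m k)).trans
      (pow_le_pow_left₀ (norm_nonneg y) hy' m)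
  · simp

theorem hasDerivAt_polylog_one {x : ℂ} (hx : ‖x‖ < 1) :
    HasDerivAt (polylog 1) (1 / (1 - x)) x := by
  have h := hasDerivAt_polylog_tsum 0 hx
  simp only [pow_zero, div_one, tsum_geometric_of_norm_lt_one hx] at h
  simpa using h

theorem hasDerivAt_polylog_succ (k : ℕ) {x : ℂ} (hx : ‖x‖ < 1) (hx0 : x ≠ 0) :
    HasDerivAt (polylog (k + 2)) (polylog (k + 1) x / x) x := by
  convert hasDerivAt_polylog_tsum (k + 1) hx using 1
  rw [polylog, ← tsum_div_const]
  refine tsum_congr fun m => ?_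
  have hm : ((m : ℂ) + 1) ≠ 0 := Nat.cast_add_one_ne_zero m
  field_simp
  ring

theorem differentiableOn_polylog (k : ℕ) : DifferentiableOn ℂ (polylog (k + 1)) (Metric.ball 0 1) :=
  fun _ hx => (hasDerivAt_polylog_tsum k (by simpa using hx)).differentiableAt.differentiableWithinAt

theorem analyticAt_polylog (k : ℕ) {x : ℂ} (hx : ‖x‖ < 1) : AnalyticAt ℂ (polylog (k + 1)) x :=
  (differentiableOn_polylog k).analyticAt (Metric.isOpen_ball.mem_nhds (by simpa using hx))

theorem polylog_one_eq {x : ℂ} (hx : ‖x‖ < 1) : polylog 1 x = -Complex.log (1 - x) := by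
  have h := (hasSum_nat_add_iff' 1).mpr (Complex.hasSum_taylorSeries_neg_log hx)
  simp only [Finset.range_one, Finset.sum_singleton, Nat.cast_zero, div_zero, sub_zero] at h
  rw [← h.tsum_eq, polylog]
  simp

theorem mem_slitPlane_of_norm_sub_one_lt {x : ℂ} (hx : ‖x - 1‖ < 1) : x ∈ Complex.slitPlane := by
  have := Complex.abs_re_le_norm (x - 1)
  rw [Complex.sub_re, Complex.one_re] at this
  exact Or.inl (by linarith [(abs_lt.mp (this.trans_lt hx)).1])

theorem norm_lt_one_of_mem_ball {x : ℂ} (hx : x ∈ Metric.ball (1 / 2 : ℂ) (1 / 2)) : ‖x‖ < 1 := by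
  rw [mem_ball_iff_norm] at hx
  have := norm_add_le (x - 1 / 2) (1 / 2)
  norm_num at this hx
  linarith

theorem norm_sub_one_lt_one_of_mem_ball {x : ℂ} (hx : x ∈ Metric.ball (1 / 2 : ℂ) (1 / 2)) :
    ‖x - 1‖ < 1 := by
  rw [mem_ball_iff_norm] at hx
  have := norm_sub_le (x - 1 / 2) (1 / 2)
  rw [show x - 1 / 2 - 1 / 2 = x - 1 by ring] at this
  norm_num at this hx
  linarith

/-- The zero of `log` at `1` cancels the pole of `1/(x-1)`. This keeps the integrand in
`exists_polylog_eq_regular_sub` holomorphic at `1`. -/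
theorem differentiableOn_dslope_log :
    DifferentiableOn ℂ (dslope Complex.log 1) (Metric.ball 1 1) := by
  rw [Complex.differentiableOn_dslope (Metric.ball_mem_nhds 1 one_pos)]
  exact fun x hx => (Complex.hasDerivAt_log
    (mem_slitPlane_of_norm_sub_one_lt (by simpa [dist_eq_norm] using hx))).differentiableAt.differentiableWithinAt

theorem hasDerivAt_log_pow_div_factorial (k : ℕ) {x : ℂ} (hx : x ∈ Complex.slitPlane) :
    HasDerivAt (fun y => Complex.log y ^ (k + 1) / ((k + 1).factorial : ℂ))
      (Complex.log x ^ k / (k.factorial : ℂ) / x) x := by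
  have h := ((Complex.hasDerivAt_log hx).pow (k + 1)).div_const ((k + 1).factorial : ℂ)
  refine h.congr_deriv ?_
  have h0 := Complex.slitPlane_ne_zero hx
  have hk : (k.factorial : ℂ) ≠ 0 := by exact_mod_cast k.factorial_ne_zero
  have hk' : (k : ℂ) + 1 ≠ 0 := Nat.cast_add_one_ne_zero k
  rw [Nat.factorial_succ]
  push_cast
  field_simp

/-- Near `x = 1` the singular part of the polylogarithm is a power of `log x` times `log (1 - x)`:
the remainder is holomorphic in the disk `|x - 1| < 1`. -/
theorem exists_polylog_eq_regular_sub (k : ℕ) : ∃ H : ℂ → ℂ, DifferentiableOn ℂ H (Metric.ball 1 1) ∧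
    ∀ x ∈ Metric.ball (1 / 2 : ℂ) (1 / 2), polylog (k + 1) x =
      H x - Complex.log x ^ k / (k.factorial : ℂ) * Complex.log (1 - x) := by
  induction k with
  | zero =>
    refine ⟨0, differentiableOn_const _, fun x hx => ?_⟩
    simp [polylog_one_eq (norm_lt_one_of_mem_ball hx)]
  | succ k ih =>
    obtain ⟨H, hH, hHe⟩ := ih
    have hlog : DifferentiableOn ℂ Complex.log (Metric.ball 1 1) := fun x hx =>
      (Complex.hasDerivAt_log (mem_slitPlane_of_norm_sub_one_lt
        (by simpa [dist_eq_norm] using hx))).differentiableAt.differentiableWithinAt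
    have hne : ∀ x ∈ Metric.ball (1 : ℂ) 1, x ≠ 0 := fun x hx =>
      Complex.slitPlane_ne_zero (mem_slitPlane_of_norm_sub_one_lt (by simpa [dist_eq_norm] using hx))
    -- This is the derivative required of the next regular part: on differentiating `ln_{k+2} x +
    -- log^{k+1} x log(1-x)/(k+1)!` the two terms in `log(1-x)` cancel.
    have hd : DifferentiableOn ℂ (fun x => H x / x + Complex.log x ^ k / ((k + 1).factorial : ℂ)
        * dslope Complex.log 1 x) (Metric.ball 1 1) :=
      (hH.div differentiableOn_id hne).add
        (((hlog.pow k).div_const _).mul differentiableOn_dslope_log)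
    -- The constant of integration makes the desired identity true at `1/2`; equality of derivatives
    -- then spreads it over the smaller disk.
    obtain ⟨G, hG0, hG⟩ := hd.isExactOn_ball.with_val_at (1 / 2)
      (polylog (k + 2) (1 / 2) +
        Complex.log (1 / 2) ^ (k + 1) / ((k + 1).factorial : ℂ) * Complex.log (1 - 1 / 2))
    refine ⟨G, fun x hx => (hG x hx).differentiableAt.differentiableWithinAt, ?_⟩
    have hball : ∀ x ∈ Metric.ball (1 / 2 : ℂ) (1 / 2), x ∈ Metric.ball (1 : ℂ) 1 := fun x hx => by
      simpa [dist_eq_norm] using norm_sub_one_lt_one_of_mem_ball hx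
    have hder : ∀ x ∈ Metric.ball (1 / 2 : ℂ) (1 / 2), HasDerivAt (fun y => G y -
        (polylog (k + 2) y + Complex.log y ^ (k + 1) / ((k + 1).factorial : ℂ)
          * Complex.log (1 - y))) 0 x := by
      intro x hx
      have hs := mem_slitPlane_of_norm_sub_one_lt (norm_sub_one_lt_one_of_mem_ball hx)
      have hx1 := norm_lt_one_of_mem_ball hx
      have hx0 := Complex.slitPlane_ne_zero hs
      have hx1' : x ≠ 1 := fun h => by simp [h] at hx1
      have hs' : 1 - x ∈ Complex.slitPlane := by
        refine mem_slitPlane_of_norm_sub_one_lt ?_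
        rwa [show 1 - x - 1 = -x by ring, norm_neg]
      have h1 : HasDerivAt (fun y => Complex.log (1 - y)) (-1 / (1 - x)) x := by
        simpa using ((hasDerivAt_id x).const_sub 1).clog hs'
      refine ((hG x (hball x hx)).sub ((hasDerivAt_polylog_succ k hx1 hx0).add
        ((hasDerivAt_log_pow_div_factorial k hs).mul h1))).congr_deriv ?_
      rw [dslope_of_ne _ hx1', slope_def_field, hHe x hx, Complex.log_one]
      have h2 : 1 - x ≠ 0 := sub_ne_zero.mpr hx1'.symm
      have h3 : x - 1 ≠ 0 := sub_ne_zero.mpr hx1'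
      have hk : ((k + 1).factorial : ℂ) ≠ 0 := by exact_mod_cast (k + 1).factorial_ne_zero
      have hk' : (k.factorial : ℂ) ≠ 0 := by exact_mod_cast k.factorial_ne_zero
      rw [show x - 1 = -(1 - x) by ring]
      field_simp
      ring
    intro x hx
    have hc : (1 / 2 : ℂ) ∈ Metric.ball (1 / 2 : ℂ) (1 / 2) := Metric.mem_ball_self (by norm_num)
    have := Metric.isOpen_ball.is_const_of_deriv_eq_zero (convex_ball _ _).isPreconnected
      (fun y hy => (hder y hy).differentiableAt.differentiableWithinAt)
      (fun y hy => (hder y hy).deriv) hx hc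
    simp only [hG0, sub_self] at this
    linear_combination -this

/-! ### Continuation of `log` and `ln_k` along the two loops. -/

/-- The branch of the logarithm near `exp (2πit) / 2` obtained by rotating the principal branch. -/
def logBranch (t : ℝ) (x : ℂ) : ℂ :=
  Complex.log (x * Complex.exp (-(2 * (Real.pi : ℂ) * Complex.I * (t : ℂ))))
    + 2 * (Real.pi : ℂ) * Complex.I * (t : ℂ)

theorem circlePoint_mul_exp (s t : ℝ) :
    circlePoint s * Complex.exp (-(2 * (Real.pi : ℂ) * Complex.I * (t : ℂ))) =
      circlePoint (s - t) := by
  rw [circlePoint, circlePoint, div_mul_eq_mul_div, ← Complex.exp_add]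
  congr 2
  push_cast
  ring

theorem analyticAt_logBranch (t : ℝ) : AnalyticAt ℂ (logBranch t) (circlePoint t) := by
  have : circlePoint t * Complex.exp (-(2 * (Real.pi : ℂ) * Complex.I * (t : ℂ))) ∈
      Complex.slitPlane := by
    rw [circlePoint_mul_exp, sub_self, circlePoint_zero]
    exact Or.inl (by norm_num)
  exact ((analyticAt_id.mul analyticAt_const).clog this).add analyticAt_const

/-- The rotated variable stays in the right half-plane and the two rotations differ by an angle
below `π/2`, so the arguments add up inside `(-π, π)` and the principal logarithm is additive. -/
theorem logBranch_eventuallyEq (t : ℝ) :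
    ∀ᶠ s in 𝓝 t, logBranch s =ᶠ[𝓝 (circlePoint s)] logBranch t := by
  have h1 : ∀ᶠ s : ℝ in 𝓝 t, 0 < (circlePoint (s - t)).re := by
    have hc : ContinuousAt (fun s : ℝ => (circlePoint (s - t)).re) t :=
      (Complex.continuous_re.comp
        (continuous_circlePoint.comp (continuous_id.sub continuous_const))).continuousAt
    refine hc.eventually_const_lt ?_
    simp [circlePoint_zero]
  have h2 : ∀ᶠ s : ℝ in 𝓝 t, |2 * Real.pi * (t - s)| < Real.pi / 2 := by
    have hc : ContinuousAt (fun s : ℝ => |2 * Real.pi * (t - s)|) t := by fun_prop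
    refine hc.eventually_lt_const ?_
    simp [Real.pi_pos]
  filter_upwards [h1, h2] with s hs hs'
  have hc : ContinuousAt
      (fun x : ℂ => (x * Complex.exp (-(2 * (Real.pi : ℂ) * Complex.I * (t : ℂ)))).re)
      (circlePoint s) := by fun_prop
  filter_upwards [hc.eventually_const_lt
    (show 0 < (circlePoint s * Complex.exp (-(2 * (Real.pi : ℂ) * Complex.I * (t : ℂ)))).re by
      rwa [circlePoint_mul_exp])] with x hx
  set w := x * Complex.exp (-(2 * (Real.pi : ℂ) * Complex.I * (t : ℂ))) with hw
  have hw0 : w ≠ 0 := fun h => by simp [h] at hx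
  have hxw : x * Complex.exp (-(2 * (Real.pi : ℂ) * Complex.I * (s : ℂ))) =
      w * Complex.exp (((2 * Real.pi * (t - s) : ℝ) : ℂ) * Complex.I) := by
    rw [hw, mul_assoc x, ← Complex.exp_add]
    congr 2
    push_cast
    ring
  have habs := abs_lt.mp hs'
  have hpi := Real.pi_pos
  have hlog : Complex.log (Complex.exp (((2 * Real.pi * (t - s) : ℝ) : ℂ) * Complex.I)) =
      ((2 * Real.pi * (t - s) : ℝ) : ℂ) * Complex.I := by
    refine Complex.log_exp ?_ ?_ <;>
    · rw [Complex.im_ofReal_mul, Complex.I_im, mul_one]; linarith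
  have harg : Complex.arg (Complex.exp (((2 * Real.pi * (t - s) : ℝ) : ℂ) * Complex.I)) =
      2 * Real.pi * (t - s) := by
    rw [← Complex.log_im, hlog]
    simp
  have hwarg := abs_lt.mp (Complex.abs_arg_lt_pi_div_two_iff.mpr (Or.inl hx))
  rw [logBranch, logBranch, ← hw, hxw, (Complex.log_mul_eq_add_log_iff hw0
    (Complex.exp_ne_zero _)).mpr, hlog]
  · push_cast
    ring
  · rw [harg]
    constructor <;> linarith

theorem logBranch_zero : logBranch 0 = Complex.log := by
  funext x
  simp [logBranch]

theorem logBranch_one (x : ℂ) :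
    logBranch 1 x = Complex.log x + 2 * (Real.pi : ℂ) * Complex.I := by
  simp [logBranch, Complex.exp_neg, Complex.exp_two_pi_mul_I]

/-- The logarithm gains `2πi` along the positive loop about `0`. -/
theorem isAnalyticContinuation_log_sigma0 : IsAnalyticContinuation Complex.log sigma0
    (fun x => Complex.log x + 2 * (Real.pi : ℂ) * Complex.I) := by
  refine ⟨fun t => logBranch t, fun t => analyticAt_logBranch t, fun t => ?_, ?_, ?_⟩
  · exact (continuous_subtype_val.tendsto t).eventually (logBranch_eventuallyEq t)
  · simp [logBranch_zero]
  · exact Eventually.of_forall fun x => by simpa using logBranch_one x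

/-- The function `log (1 - x)` gains `2πi` along the positive loop about `1`. -/
theorem isAnalyticContinuation_log_one_sub_sigma1 :
    IsAnalyticContinuation (fun x => Complex.log (1 - x)) sigma1
      (fun x => Complex.log (1 - x) + 2 * (Real.pi : ℂ) * Complex.I) := by
  have hv : ∀ t : unitInterval, 1 - (sigma1 t : ℂ) = circlePoint t := fun t => sub_sub_cancel _ _
  refine ⟨fun t x => logBranch t (1 - x), fun t => ?_, fun t => ?_, ?_, ?_⟩
  · have h := analyticAt_logBranch t
    rw [← hv] at h
    exact h.comp (f := fun x => 1 - x) (analyticAt_const.sub analyticAt_id)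
  · filter_upwards [(continuous_subtype_val.tendsto t).eventually (logBranch_eventuallyEq t)]
      with s hs
    rw [← hv] at hs
    exact (continuous_const.sub continuous_id).continuousAt.eventually hs
  · simp [logBranch_zero]
  · exact Eventually.of_forall fun x => by simpa using logBranch_one (1 - x)

theorem norm_sigma0 (t : unitInterval) : ‖(sigma0 t : ℂ)‖ < 1 := by
  have : ‖(sigma0 t : ℂ)‖ = 1 / 2 := norm_circlePoint t
  rw [this]
  norm_num

theorem norm_sigma1_sub_one (t : unitInterval) : ‖(sigma1 t : ℂ) - 1‖ < 1 := by
  have : (sigma1 t : ℂ) - 1 = -circlePoint t := sub_sub_cancel_left _ _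
  rw [this, norm_neg, norm_circlePoint]
  norm_num

theorem isAnalyticContinuation_polylog_sigma0 (k : ℕ) :
    IsAnalyticContinuation (polylog (k + 1)) sigma0 (polylog (k + 1)) :=
  .of_analyticAt fun t => analyticAt_polylog k (norm_sigma0 t)

theorem isAnalyticContinuation_log_sigma1 :
    IsAnalyticContinuation Complex.log sigma1 Complex.log :=
  .of_analyticAt fun t => analyticAt_clog (mem_slitPlane_of_norm_sub_one_lt (norm_sigma1_sub_one t))

theorem ball_mem_nhds_base : Metric.ball (1 / 2 : ℂ) (1 / 2) ∈ 𝓝 (base : ℂ) :=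
  Metric.ball_mem_nhds _ (by norm_num)

/-- The monodromy of the polylogarithm about `1`. -/
theorem isAnalyticContinuation_polylog_sigma1 (k : ℕ) :
    IsAnalyticContinuation (polylog (k + 1)) sigma1
      (fun x => polylog (k + 1) x
        - 2 * (Real.pi : ℂ) * Complex.I / (k.factorial : ℂ) * Complex.log x ^ k) := by
  obtain ⟨H, hH, hHe⟩ := exists_polylog_eq_regular_sub k
  have hc : IsAnalyticContinuation H sigma1 H := .of_analyticAt fun t =>
    hH.analyticAt (Metric.isOpen_ball.mem_nhds (mem_ball_iff_norm.mpr (norm_sigma1_sub_one t)))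
  refine (hc.add (((isAnalyticContinuation_log_sigma1.pow k).mul
    isAnalyticContinuation_log_one_sub_sigma1).const_mul (-(k.factorial : ℂ)⁻¹))).congr ?_ ?_
  · filter_upwards [ball_mem_nhds_base] with x hx
    rw [hHe x hx]
    ring
  · filter_upwards [ball_mem_nhds_base] with x hx
    rw [hHe x hx]
    ring

/-! ### The matrices of the two loops acting on `Λ`. -/

theorem fundMatrix_apply (n : ℕ) (x : ℂ) (j k : Fin (n + 1)) : fundMatrix n x j k =
    if (k : ℕ) < j then 0
    else if (j : ℕ) = 0 then (if (k : ℕ) = 0 then 1 else polylog k x)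
    else (2 * (Real.pi : ℂ) * Complex.I) ^ (j : ℕ) / (((k : ℕ) - (j : ℕ)).factorial : ℂ)
      * Complex.log x ^ ((k : ℕ) - (j : ℕ)) := rfl

theorem shift_apply (n : ℕ) (i j : Fin n) : shift n i j = if (j : ℕ) = i + 1 then 1 else 0 := rfl

theorem shift_pow_apply (n m : ℕ) (i l : Fin n) :
    (shift n ^ m) i l = if (l : ℕ) = i + m then 1 else 0 := by
  induction m generalizing l with
  | zero => simp [Matrix.one_apply, Fin.ext_iff, eq_comm]
  | succ m ih =>
    rw [pow_succ, Matrix.mul_apply]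
    simp only [ih, shift_apply, ite_mul, one_mul, zero_mul]
    by_cases h : (l : ℕ) = i + (m + 1)
    · rw [if_pos h, Finset.sum_eq_single ⟨i + m, by omega⟩]
      · simp [h, add_assoc]
      · intro b _ hb
        rw [if_neg fun h' => hb (Fin.ext h')]
      · simp
    · rw [if_neg h]
      refine Finset.sum_eq_zero fun b _ => ?_
      split_ifs <;> first | rfl | omega

theorem exp_shift_apply (n : ℕ) (i l : Fin n) :
    NormedSpace.exp (shift n) i l =
      if (i : ℕ) ≤ l then (((l : ℕ) - (i : ℕ)).factorial : ℂ)⁻¹ else 0 := by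
  -- Any normed algebra structure serves; it is needed only to sum the exponential series.
  let _ : NormedRing (Matrix (Fin n) (Fin n) ℂ) := Matrix.linftyOpNormedRing
  let _ : NormedAlgebra ℂ (Matrix (Fin n) (Fin n) ℂ) := Matrix.linftyOpNormedAlgebra
  have h := NormedSpace.exp_series_hasSum_exp' (𝕂 := ℂ) (shift n)
  have h' : HasSum (fun m : ℕ => ((m.factorial : ℂ)⁻¹ • shift n ^ m) i l)
      (NormedSpace.exp (shift n) i l) := Pi.hasSum.mp (Pi.hasSum.mp h i) l
  simp only [Matrix.smul_apply, shift_pow_apply, smul_eq_mul] at h'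
  refine h'.unique ?_
  split_ifs with hil
  · convert hasSum_single ((l : ℕ) - i) fun m hm => ?_ using 1
    · rw [if_pos (by omega), mul_one]
    · rw [if_neg (by omega), mul_zero]
  · convert hasSum_zero using 2 with m
    rw [if_neg (by omega), mul_zero]

/-- The binomial expansion of `(L + a)^d` divided by `d!`, with `d = k - (i+1)`. The shifts by one
occur because row `i` of the block `J` is row `i + 1` of the full matrix. -/
theorem sum_inv_factorial_mul_pow (a L : ℂ) {n i k : ℕ} (hk : k ≤ n) :
    ∑ l : Fin n, (if i ≤ (l : ℕ) then (((l : ℕ) - i).factorial : ℂ)⁻¹ else 0) *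
        (if k < l + 1 then 0 else a ^ ((l : ℕ) + 1) / ((k - ((l : ℕ) + 1)).factorial : ℂ)
          * L ^ (k - ((l : ℕ) + 1))) =
      if k < i + 1 then 0 else
        a ^ (i + 1) / ((k - (i + 1)).factorial : ℂ) * (L + a) ^ (k - (i + 1)) := by
  rw [Fin.sum_univ_eq_sum_range (fun l => (if i ≤ l then ((l - i).factorial : ℂ)⁻¹ else 0) *
        (if k < l + 1 then 0 else a ^ (l + 1) / ((k - (l + 1)).factorial : ℂ)
          * L ^ (k - (l + 1)))) n]
  split_ifs with h
  · refine Finset.sum_eq_zero fun l _ => ?_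
    split_ifs <;> first | omega | simp
  · obtain ⟨d, rfl⟩ := Nat.exists_eq_add_of_le (not_lt.mp h)
    -- Only `i ≤ l ≤ i + d` contributes, and `k ≤ n` puts this interval inside the range of
    -- summation.
    rw [← Finset.sum_subset (s₁ := Finset.Ico i (i + (d + 1))) (fun l hl => ?_) fun l hl hl' => ?_]
    · rw [Finset.sum_Ico_eq_sum_range, add_tsub_cancel_left, add_tsub_cancel_left, add_comm L a,
        add_pow, Finset.mul_sum]
      refine Finset.sum_congr rfl fun m hm => ?_
      have hmd : m ≤ d := Nat.lt_succ_iff.mp (Finset.mem_range.mp hm)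
      rw [if_pos (by omega), if_neg (by omega), Nat.cast_choose ℂ hmd,
        show i + 1 + d - (i + m + 1) = d - m by omega, add_tsub_cancel_left]
      have h1 : (d.factorial : ℂ) ≠ 0 := by exact_mod_cast d.factorial_ne_zero
      have h2 : (m.factorial : ℂ) ≠ 0 := by exact_mod_cast m.factorial_ne_zero
      have h3 : ((d - m).factorial : ℂ) ≠ 0 := by exact_mod_cast (d - m).factorial_ne_zero
      field_simp
      ring
    · simp only [Finset.mem_Ico, Finset.mem_range] at hl ⊢
      omega
    · simp only [Finset.mem_Ico, Finset.mem_range] at hl hl'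
      split_ifs <;> first | omega | simp

/-- The effect on `Λ` of adding `2πi` to the logarithm. -/
theorem blockOne_exp_shift_mul_fundMatrix (n : ℕ) (x : ℂ) (j k : Fin (n + 1)) :
    (blockOne (NormedSpace.exp (shift n)) * fundMatrix n x) j k =
      if (k : ℕ) < j then 0
      else if (j : ℕ) = 0 then (if (k : ℕ) = 0 then 1 else polylog k x)
      else (2 * (Real.pi : ℂ) * Complex.I) ^ (j : ℕ) / (((k : ℕ) - (j : ℕ)).factorial : ℂ)
        * (Complex.log x + 2 * (Real.pi : ℂ) * Complex.I) ^ ((k : ℕ) - (j : ℕ)) := by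
  rw [Matrix.mul_apply, Fin.sum_univ_succ]
  refine Fin.cases ?_ (fun i => ?_) j
  · simp [blockOne, fundMatrix]
  · have h := sum_inv_factorial_mul_pow (2 * (Real.pi : ℂ) * Complex.I) (Complex.log x) (n := n)
      (i := i) (k := k) (Nat.lt_succ_iff.mp k.2)
    simpa [blockOne, fundMatrix_apply, exp_shift_apply, -Fin.val_fin_lt, -Fin.val_fin_le] using h

/-- Left multiplication subtracts row `1` from row `0`, and row `1` of `Λ` is exactly the jump of
the polylogarithms about `1`. -/
theorem unipotentOne_mul_fundMatrix (n : ℕ) (x : ℂ) (j k : Fin (n + 1)) :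
    (unipotentOne n * fundMatrix n x) j k = fundMatrix n x j k -
      if (j : ℕ) = 0 ∧ 1 ≤ (k : ℕ) then
        2 * (Real.pi : ℂ) * Complex.I / (((k : ℕ) - 1).factorial : ℂ)
          * Complex.log x ^ ((k : ℕ) - 1) else 0 := by
  have hU : unipotentOne n = 1 - Matrix.of fun i j : Fin (n + 1) =>
      if (i : ℕ) = 0 ∧ (j : ℕ) = 1 then 1 else 0 := by
    ext i j
    simp only [unipotentOne, Matrix.of_apply, Matrix.sub_apply, Matrix.one_apply]
    split_ifs <;> first | omega | simp
  rw [hU, sub_mul, one_mul, Matrix.sub_apply, Matrix.mul_apply]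
  congr 1
  simp only [Matrix.of_apply, ite_mul, one_mul, zero_mul]
  split_ifs with h
  · rw [Finset.sum_eq_single (⟨1, by omega⟩ : Fin (n + 1))]
    · rw [if_pos ⟨h.1, rfl⟩, fundMatrix_apply, if_neg h.2.not_gt, if_neg one_ne_zero, pow_one]
    · intro l _ hl
      rw [if_neg fun h' => hl (Fin.ext h'.2)]
    · simp
  · refine Finset.sum_eq_zero fun l _ => ?_
    split_ifs with hl
    · rw [fundMatrix, Matrix.of_apply, if_pos (by omega)]
    · rfl

theorem isMatrixContinuation_sigma0 (n : ℕ) : IsMatrixContinuation (fundMatrix n) sigma0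
    (fun x => blockOne (NormedSpace.exp (shift n)) * fundMatrix n x) := by
  intro j k
  simp only [blockOne_exp_shift_mul_fundMatrix]
  simp only [fundMatrix, Matrix.of_apply]
  split_ifs with h1 h2 h3
  · exact .const 0
  · exact .const 1
  · obtain ⟨m, hm⟩ := Nat.exists_eq_succ_of_ne_zero h3
    rw [hm]
    exact isAnalyticContinuation_polylog_sigma0 m
  · exact (isAnalyticContinuation_log_sigma0.pow _).const_mul _

theorem isMatrixContinuation_sigma1 (n : ℕ) : IsMatrixContinuation (fundMatrix n) sigma1
    (fun x => unipotentOne n * fundMatrix n x) := by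
  intro j k
  simp only [unipotentOne_mul_fundMatrix]
  simp only [fundMatrix, Matrix.of_apply]
  split_ifs with h1 h2 h3 h4 h5 h6
  · omega
  · simpa using IsAnalyticContinuation.const 0
  · omega
  · simpa using IsAnalyticContinuation.const 1
  · obtain ⟨m, hm⟩ := Nat.exists_eq_succ_of_ne_zero h4
    rw [hm]
    exact isAnalyticContinuation_polylog_sigma1 m
  · omega
  · omega
  · simpa only [sub_zero] using (isAnalyticContinuation_log_sigma1.pow _).const_mul _

/-- The matrix is triangular with the nonzero constants `(2πi)^j` on its diagonal, so no restriction
on `x` is needed. -/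
theorem isUnit_fundMatrix (n : ℕ) (x : ℂ) : IsUnit (fundMatrix n x) := by
  rw [Matrix.isUnit_iff_isUnit_det, Matrix.det_of_isUpperTriangular, isUnit_iff_ne_zero,
    Finset.prod_ne_zero_iff]
  · intro i _
    by_cases hi : (i : ℕ) = 0
    · rw [fundMatrix_apply, if_neg (lt_irrefl _), if_pos hi, if_pos hi]
      exact one_ne_zero
    · rw [fundMatrix_apply, if_neg (lt_irrefl _), if_neg hi]
      simp [Real.pi_ne_zero, Complex.I_ne_zero]
  · intro i j hij
    exact if_pos hij

/-- The matrix by which `Λ` is multiplied under continuation along a loop is unique. -/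
theorem eq_of_isMatrixContinuation {n : ℕ} {γ : Path base base}
    {A B : Matrix (Fin (n + 1)) (Fin (n + 1)) ℂ}
    (hA : IsMatrixContinuation (fundMatrix n) γ (fun x => A * fundMatrix n x))
    (hB : IsMatrixContinuation (fundMatrix n) γ (fun x => B * fundMatrix n x)) : A = B := by
  refine (isUnit_fundMatrix n base).mul_right_cancel (Matrix.ext fun i j => ?_)
  exact ((hA i j).unique (hB i j) EventuallyEq.rfl).self_of_nhds

/-! ### The differential system satisfied by `Λ`. -/

section Solutions

/-- The coefficients of the system `Y' = Y A` satisfied by `Λ`: column `k + 1` has derivative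
`connectionCoeff k` times column `k`. -/
def connectionCoeff (k : ℕ) (x : ℂ) : ℂ := if k = 0 then 1 / (1 - x) else 1 / x

/-- The matrix function `Y` satisfies at `x` the differential system of the polylogarithms. -/
def SolvesAt {n : ℕ} (Y : ℂ → Matrix (Fin (n + 1)) (Fin (n + 1)) ℂ) (x : ℂ) : Prop :=
  ∀ j, HasDerivAt (fun z => Y z j 0) 0 x ∧
    ∀ k : Fin n, HasDerivAt (fun z => Y z j k.succ) (Y x j k.castSucc * connectionCoeff k x) x

variable {n : ℕ} {Y Z : ℂ → Matrix (Fin (n + 1)) (Fin (n + 1)) ℂ} {x : ℂ}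

theorem SolvesAt.mul_left (h : SolvesAt Y x) (C : Matrix (Fin (n + 1)) (Fin (n + 1)) ℂ) :
    SolvesAt (fun z => C * Y z) x := by
  intro j
  simp only [Matrix.mul_apply]
  refine ⟨?_, fun k => ?_⟩
  · have := HasDerivAt.fun_sum fun l (_ : l ∈ Finset.univ) => (h l).1.const_mul (C j l)
    simpa using this
  · have := HasDerivAt.fun_sum fun l (_ : l ∈ Finset.univ) => ((h l).2 k).const_mul (C j l)
    simpa only [Finset.sum_mul, mul_assoc] using this

theorem SolvesAt.differentiableAt (h : SolvesAt Y x) (j k : Fin (n + 1)) :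
    DifferentiableAt ℂ (fun z => Y z j k) x :=
  Fin.cases (h j).1.differentiableAt (fun k => ((h j).2 k).differentiableAt) k

theorem SolvesAt.analyticAt (h : ∀ᶠ z in 𝓝 x, SolvesAt Y z) (j k : Fin (n + 1)) :
    AnalyticAt ℂ (fun z => Y z j k) x :=
  Complex.analyticAt_iff_eventually_differentiableAt.mpr
    (h.mono fun _ hz => hz.differentiableAt j k)

/-- Two solutions on a connected open set that agree at a point agree. -/
theorem SolvesAt.eqOn {U : Set ℂ} (hU : IsOpen U) (hc : IsPreconnected U)
    (hY : ∀ z ∈ U, SolvesAt Y z) (hZ : ∀ z ∈ U, SolvesAt Z z) {a : ℂ} (ha : a ∈ U)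
    (h : Y a = Z a) : Set.EqOn Y Z U := by
  have key : ∀ j k : Fin (n + 1), ∀ z ∈ U, Y z j k = Z z j k := by
    intro j k
    have const : ∀ l : Fin (n + 1), (∀ z ∈ U, HasDerivAt (fun z => Y z j l - Z z j l) 0 z) →
        ∀ z ∈ U, Y z j l = Z z j l := fun l hl z hz => by
      have := hU.is_const_of_deriv_eq_zero hc
        (fun y hy => (hl y hy).differentiableAt.differentiableWithinAt)
        (fun y hy => (hl y hy).deriv) hz ha
      simpa [h, sub_eq_zero] using this
    -- The system is solved column by column: once column `k` agrees, the difference of the next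
    -- columns has derivative `0`.
    induction k using Fin.induction with
    | zero => exact const 0 fun z hz => ((hY z hz j).1.sub (hZ z hz j).1).congr_deriv (sub_zero 0)
    | succ k ih =>
      refine const _ fun z hz => ?_
      have := ((hY z hz j).2 k).sub ((hZ z hz j).2 k)
      rwa [ih z hz, sub_self] at this
  exact fun z hz => Matrix.ext fun j k => key j k z hz

theorem SolvesAt.eventuallyEq (hY : ∀ᶠ z in 𝓝 x, SolvesAt Y z) (hZ : ∀ᶠ z in 𝓝 x, SolvesAt Z z)
    (h : Y x = Z x) : Y =ᶠ[𝓝 x] Z := by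
  obtain ⟨ε, hε, hball⟩ := Metric.eventually_nhds_iff_ball.mp (hY.and hZ)
  exact eventuallyEq_of_mem (Metric.ball_mem_nhds x hε)
    (SolvesAt.eqOn Metric.isOpen_ball (convex_ball _ _).isPreconnected
      (fun z hz => (hball z hz).1) (fun z hz => (hball z hz).2) (Metric.mem_ball_self hε) h)

theorem differentiableOn_connectionCoeff {U : Set ℂ} (h0 : (0 : ℂ) ∉ U) (h1 : (1 : ℂ) ∉ U) (k : ℕ) :
    DifferentiableOn ℂ (connectionCoeff k) U := by
  have hd : ∀ z ∈ U, z ≠ 0 ∧ 1 - z ≠ 0 := fun z hz =>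
    ⟨fun h => h0 (h ▸ hz), fun h => h1 (sub_eq_zero.mp h ▸ hz)⟩
  by_cases hk : k = 0
  · subst hk
    exact ((differentiableOn_const 1).div ((differentiableOn_const 1).sub differentiableOn_id)
      fun z hz => (hd z hz).2).congr fun z _ => if_pos rfl
  · exact ((differentiableOn_const 1).div differentiableOn_id
      fun z hz => (hd z hz).1).congr fun z _ => if_neg hk

/-- A row of a solution with prescribed value at a point, on a disk omitting `0` and `1`. -/
theorem exists_row_solution {c : ℂ} {r : ℝ} (h0 : (0 : ℂ) ∉ Metric.ball c r)
    (h1 : (1 : ℂ) ∉ Metric.ball c r) (a : ℂ) (v : ℕ → ℂ) :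
    ∃ y : ℕ → ℂ → ℂ, (∀ k, y k a = v k) ∧ ∀ x ∈ Metric.ball c r, HasDerivAt (y 0) 0 x ∧
      ∀ k, HasDerivAt (y (k + 1)) (y k x * connectionCoeff k x) x := by
  -- Holomorphy is carried in the subtype so that the recursion can integrate again at each stage.
  have step : ∀ (k : ℕ) (f : {f : ℂ → ℂ // DifferentiableOn ℂ f (Metric.ball c r)}),
      ∃ g : {f : ℂ → ℂ // DifferentiableOn ℂ f (Metric.ball c r)}, g.1 a = v (k + 1) ∧
        ∀ x ∈ Metric.ball c r, HasDerivAt g.1 (f.1 x * connectionCoeff k x) x := fun k f => by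
    obtain ⟨g, hga, hg⟩ := (f.2.mul
      (differentiableOn_connectionCoeff h0 h1 k)).isExactOn_ball.with_val_at a (v (k + 1))
    exact ⟨⟨g, fun x hx => (hg x hx).differentiableAt.differentiableWithinAt⟩, hga, hg⟩
  choose next hnext hnext' using step
  let y : ℕ → {f : ℂ → ℂ // DifferentiableOn ℂ f (Metric.ball c r)} :=
    fun k => Nat.rec ⟨fun _ => v 0, differentiableOn_const _⟩ next k
  refine ⟨fun k => (y k).1, fun k => ?_, fun x hx => ⟨hasDerivAt_const x (v 0), fun k => ?_⟩⟩
  · cases k with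
    | zero => rfl
    | succ k => exact hnext k (y k)
  · exact hnext' k (y k) x hx

theorem exists_solution (n : ℕ) {c : ℂ} {r : ℝ} (h0 : (0 : ℂ) ∉ Metric.ball c r)
    (h1 : (1 : ℂ) ∉ Metric.ball c r) (a : ℂ) :
    ∃ S : ℂ → Matrix (Fin (n + 1)) (Fin (n + 1)) ℂ, S a = 1 ∧
      ∀ x ∈ Metric.ball c r, SolvesAt S x := by
  choose y hya hy using fun j : Fin (n + 1) => exists_row_solution h0 h1 a
    fun k => if (j : ℕ) = k then 1 else 0
  refine ⟨fun x => Matrix.of fun j k => y j k x, ?_, fun x hx j => ⟨(hy j x hx).1, fun k => ?_⟩⟩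
  · ext j k
    simp [hya, Matrix.one_apply, Fin.ext_iff]
  · exact (hy j x hx).2 k

/-- A solution that is invertible at the center of a disk omitting `0` and `1` is invertible
throughout the disk. -/
theorem isUnit_of_solvesAt {c : ℂ} {r : ℝ} (h0 : (0 : ℂ) ∉ Metric.ball c r)
    (h1 : (1 : ℂ) ∉ Metric.ball c r) {a : ℂ} (ha : a ∈ Metric.ball c r) (hYa : Y a = 1)
    (hY : ∀ x ∈ Metric.ball c r, SolvesAt Y x) (hx : x ∈ Metric.ball c r) : IsUnit (Y x) := by
  -- With `T x = 1`, uniqueness gives `Y = Y(x) T`; at `a` this reads `1 = Y(x) T(a)`.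
  obtain ⟨T, hTx, hT⟩ := exists_solution n h0 h1 x
  have := SolvesAt.eqOn Metric.isOpen_ball (convex_ball _ _).isPreconnected hY
    (fun z hz => (hT z hz).mul_left (Y x)) hx (by rw [hTx, mul_one]) ha
  exact IsUnit.of_mul_eq_one _ (this.symm.trans hYa)

theorem solvesAt_fundMatrix (n : ℕ) {x : ℂ} (hx : x ∈ Metric.ball (1 / 2 : ℂ) (1 / 2)) :
    SolvesAt (fundMatrix n) x := by
  have hx1 := norm_lt_one_of_mem_ball hx
  have hs := mem_slitPlane_of_norm_sub_one_lt (norm_sub_one_lt_one_of_mem_ball hx)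
  have hx0 := Complex.slitPlane_ne_zero hs
  intro j
  simp only [fundMatrix_apply]
  refine ⟨?_, fun k => ?_⟩
  · have : ∀ z : ℂ, (if ((0 : Fin (n + 1)) : ℕ) < j then 0 else if (j : ℕ) = 0 then
        (if ((0 : Fin (n + 1)) : ℕ) = 0 then 1 else polylog (0 : Fin (n + 1)) z)
        else (2 * (Real.pi : ℂ) * Complex.I) ^ (j : ℕ) /
          ((((0 : Fin (n + 1)) : ℕ) - (j : ℕ)).factorial : ℂ)
          * Complex.log z ^ (((0 : Fin (n + 1)) : ℕ) - (j : ℕ))) =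
        if (j : ℕ) = 0 then 1 else 0 := fun z => by
      rw [Fin.val_zero]
      split_ifs <;> first | omega | rfl
    simp only [this]
    exact hasDerivAt_const _ _
  · simp only [Fin.val_succ, Fin.val_castSucc, Nat.add_eq_zero_iff, one_ne_zero, and_false, if_false]
    obtain ⟨j, hj⟩ := j
    obtain ⟨k, hk⟩ := k
    simp only
    rcases Nat.lt_trichotomy (k + 1) j with h | h | h
    · simp only [if_pos h, if_pos (show k < j by omega), zero_mul]
      exact hasDerivAt_const _ _
    · subst h
      simp only [lt_irrefl, if_false, Nat.add_eq_zero_iff, one_ne_zero, and_false,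
        if_pos (Nat.lt_succ_self k), tsub_self, pow_zero, zero_mul]
      exact hasDerivAt_const _ _
    · simp only [if_neg h.not_gt, if_neg (show ¬ k < j by omega)]
      by_cases hj0 : j = 0
      · simp only [if_pos hj0]
        obtain _ | k := k
        · simpa [connectionCoeff] using hasDerivAt_polylog_one hx1
        · simpa [connectionCoeff, div_eq_mul_inv] using hasDerivAt_polylog_succ k hx1 hx0
      · simp only [if_neg hj0]
        obtain ⟨d, rfl⟩ := Nat.exists_eq_add_of_le (Nat.lt_succ_iff.mp h)
        have := (hasDerivAt_log_pow_div_factorial d hs).const_mul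
          ((2 * (Real.pi : ℂ) * Complex.I) ^ j)
        rw [add_assoc, add_tsub_cancel_left, add_tsub_cancel_left, connectionCoeff,
          if_neg (by omega)]
        exact (this.congr_of_eventuallyEq (Eventually.of_forall fun z => by ring)).congr_deriv
          (by ring)

end Solutions

theorem IsAnalyticContinuation.sum {a b : PuncturedPlane} {γ : Path a b} {ι : Type*} (s : Finset ι)
    {f g : ι → ℂ → ℂ} (h : ∀ i ∈ s, IsAnalyticContinuation (f i) γ (g i)) :
    IsAnalyticContinuation (fun x => ∑ i ∈ s, f i x) γ (fun x => ∑ i ∈ s, g i x) := by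
  induction s using Finset.cons_induction with
  | empty => simpa using const 0
  | cons i s hi ih =>
    simp only [Finset.sum_cons]
    exact (h i (Finset.mem_cons_self i s)).add
      (ih fun l hl => h l (Finset.mem_cons_of_mem hl))

theorem IsMatrixContinuation.mul_left {ι : Type} [Fintype ι] {a b : PuncturedPlane} {γ : Path a b}
    {f g : ℂ → Matrix ι ι ℂ} (h : IsMatrixContinuation f γ g) (C : Matrix ι ι ℂ) :
    IsMatrixContinuation (fun x => C * f x) γ (fun x => C * g x) := fun i j => by
  simp only [Matrix.mul_apply]
  exact .sum _ fun l _ => (h l j).const_mul (C i l)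

/-! ### The solutions as a covering space. -/

/-- A disk about `a` in `ℂ - {0, 1}`. -/
def disk (a : PuncturedPlane) : Set ℂ := Metric.ball a (min ‖(a : ℂ)‖ ‖(a : ℂ) - 1‖)

theorem mem_disk_self (a : PuncturedPlane) : (a : ℂ) ∈ disk a :=
  Metric.mem_ball_self (lt_min (norm_pos_iff.mpr a.2.1) (norm_pos_iff.mpr (sub_ne_zero.mpr a.2.2)))

theorem isOpen_disk (a : PuncturedPlane) : IsOpen (disk a) := Metric.isOpen_ball

theorem zero_notMem_disk (a : PuncturedPlane) : (0 : ℂ) ∉ disk a := fun h => by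
  rw [disk, mem_ball_iff_norm, zero_sub, norm_neg] at h
  exact (h.trans_le (min_le_left _ _)).false

theorem one_notMem_disk (a : PuncturedPlane) : (1 : ℂ) ∉ disk a := fun h => by
  rw [disk, mem_ball_iff_norm, norm_sub_rev] at h
  exact (h.trans_le (min_le_right _ _)).false

/-- The solution on `disk a` that is the identity matrix at `a`. -/
def localSolution (n : ℕ) (a : PuncturedPlane) : ℂ → Matrix (Fin (n + 1)) (Fin (n + 1)) ℂ :=
  (exists_solution n (zero_notMem_disk a) (one_notMem_disk a) a).choose

theorem localSolution_self (n : ℕ) (a : PuncturedPlane) : localSolution n a a = 1 :=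
  (exists_solution n (zero_notMem_disk a) (one_notMem_disk a) a).choose_spec.1

theorem solvesAt_localSolution (n : ℕ) (a : PuncturedPlane) {x : ℂ} (hx : x ∈ disk a) :
    SolvesAt (localSolution n a) x :=
  (exists_solution n (zero_notMem_disk a) (one_notMem_disk a) a).choose_spec.2 x hx

theorem isUnit_det_localSolution (n : ℕ) (a : PuncturedPlane) {x : ℂ} (hx : x ∈ disk a) :
    IsUnit (localSolution n a x).det :=
  (Matrix.isUnit_iff_isUnit_det _).mp <|
    isUnit_of_solvesAt (zero_notMem_disk a) (one_notMem_disk a) (mem_disk_self a)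
      (localSolution_self n a) (fun _ hz => solvesAt_localSolution n a hz) hx

/-- Two disks meet in a convex set, where the two solutions differ by a constant left factor.
Constancy of this factor makes the coordinate changes continuous for the discrete topology on the
fiber. -/
theorem localSolution_mul_inv_eq (n : ℕ) (a b : PuncturedPlane) {x y : ℂ}
    (hx : x ∈ disk a ∩ disk b) (hy : y ∈ disk a ∩ disk b) :
    localSolution n a x * (localSolution n b x)⁻¹ =
      localSolution n a y * (localSolution n b y)⁻¹ := by
  have := SolvesAt.eqOn ((isOpen_disk a).inter (isOpen_disk b))
    ((convex_ball _ _).inter (convex_ball _ _)).isPreconnected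
    (fun z hz => solvesAt_localSolution n a hz.1)
    (fun z hz => (solvesAt_localSolution n b hz.2).mul_left
      (localSolution n a x * (localSolution n b x)⁻¹)) hx
    (Matrix.nonsing_inv_mul_cancel_right _ _ (isUnit_det_localSolution n b hx.2)).symm hy
  rw [this, Matrix.mul_nonsing_inv_cancel_right _ _ (isUnit_det_localSolution n b hy.2)]

/-- The set of values of solutions, with the discrete topology. -/
@[ext] structure SolutionFiber (n : ℕ) where
  /-- The value of a solution. -/
  val : Matrix (Fin (n + 1)) (Fin (n + 1)) ℂ

instance (n : ℕ) : TopologicalSpace (SolutionFiber n) := ⊥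

instance (n : ℕ) : DiscreteTopology (SolutionFiber n) := ⟨rfl⟩

/-- The local system of the solutions of the differential system of the polylogarithms. -/
def solutionCore (n : ℕ) : FiberBundleCore PuncturedPlane PuncturedPlane (SolutionFiber n) where
  baseSet a := Subtype.val ⁻¹' disk a
  isOpen_baseSet a := (isOpen_disk a).preimage continuous_subtype_val
  indexAt := id
  mem_baseSet_at := mem_disk_self
  -- In the chart `a`, the solution `C * localSolution n a` has coordinate `C`, its value at `a`.
  -- Since `x` indexes its own chart, the fiber coordinate over `x` is the value at `x`.
  coordChange a b x Y := ⟨Y.val * (localSolution n a x * (localSolution n b x)⁻¹)⟩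
  coordChange_self a x hx Y := by
    ext1
    rw [Matrix.mul_nonsing_inv _ (isUnit_det_localSolution n a hx), mul_one]
  continuousOn_coordChange a b := by
    rintro ⟨x, Y⟩ ⟨hx, -⟩
    refine continuousWithinAt_prod_of_discrete_right.mpr ?_
    refine continuousWithinAt_const.congr (fun y hy => ?_) rfl
    exact congrArg (fun C => SolutionFiber.mk (Y.val * C))
      (localSolution_mul_inv_eq n a b hy.1 hx)
  coordChange_comp a b c x hx Y := by
    ext1
    simp only
    rw [mul_assoc, mul_assoc, Matrix.nonsing_inv_mul_cancel_left _ _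
      (isUnit_det_localSolution n b hx.1.2)]

theorem isCoveringMap_solutionCore (n : ℕ) : IsCoveringMap (solutionCore n).proj :=
  .mk _ (fun _ => SolutionFiber n) (fun x => (solutionCore n).localTrivAt x)
    fun x => (solutionCore n).mem_localTrivAt_baseSet x

/-- The value of a point of the total space of the local system. -/
def solutionValue {n : ℕ} (e : (solutionCore n).TotalSpace) :
    Matrix (Fin (n + 1)) (Fin (n + 1)) ℂ := SolutionFiber.val e.2

/-- Along a continuous path in the total space of the local system, the values are locally those
of one solution. -/
theorem eventually_solutionValue_eq {T : Type*} [TopologicalSpace T] {n : ℕ}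
    {Γ : T → (solutionCore n).TotalSpace} (hΓ : Continuous Γ) (t : T) :
    ∀ᶠ s in 𝓝 t, ((Γ s).proj : ℂ) ∈ disk (Γ t).proj ∧
      solutionValue (Γ s) = solutionValue (Γ t) * localSolution n (Γ t).proj (Γ s).proj := by
  set e := (solutionCore n).localTrivAt (Γ t).proj with he
  have hsrc : Γ t ∈ e.source := (solutionCore n).mk_mem_localTrivAt_source _ _
  have hcont : ContinuousAt (fun s => (e (Γ s)).2) t :=
    continuous_snd.continuousAt.comp ((e.continuousAt hsrc).comp hΓ.continuousAt)
  have hval : ∀ s, (e (Γ s)).2.val = solutionValue (Γ s) * (localSolution n (Γ s).proj (Γ s).proj *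
    (localSolution n (Γ t).proj (Γ s).proj)⁻¹) := fun s => rfl
  have hev : ∀ᶠ s in 𝓝 t, (e (Γ s)).2 = (e (Γ t)).2 :=
    hcont.eventually (eventually_of_mem (IsOpen.mem_nhds (isOpen_discrete {(e (Γ t)).2}) rfl)
      fun _ h => h)
  have hdisk : ∀ᶠ s in 𝓝 t, ((Γ s).proj : ℂ) ∈ disk (Γ t).proj :=
    (continuous_subtype_val.comp ((isCoveringMap_solutionCore n).continuous.comp
      hΓ)).continuousAt.eventually ((isOpen_disk _).mem_nhds (mem_disk_self _))
  filter_upwards [hev, hdisk] with s hs hsd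
  refine ⟨hsd, ?_⟩
  replace hs := congrArg SolutionFiber.val hs
  rw [hval, hval, localSolution_self, localSolution_self, one_mul, inv_one, mul_one, mul_one] at hs
  rw [← hs, mul_assoc, Matrix.nonsing_inv_mul _ (isUnit_det_localSolution n _ hsd), mul_one]

/-- A lift of a path to the local system is an analytic continuation of solutions. -/
theorem isMatrixContinuation_of_lift {n : ℕ} {a b : PuncturedPlane} {γ : Path a b}
    {f g : ℂ → Matrix (Fin (n + 1)) (Fin (n + 1)) ℂ} (hf : ∀ᶠ x in 𝓝 (a : ℂ), SolvesAt f x)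
    (hg : ∀ᶠ x in 𝓝 (b : ℂ), SolvesAt g x) {Γ : unitInterval → (solutionCore n).TotalSpace}
    (hΓ : Continuous Γ) (hγ : ∀ t, (Γ t).proj = γ t) (h0 : solutionValue (Γ 0) = f a)
    (h1 : solutionValue (Γ 1) = g b) : IsMatrixContinuation f γ g := by
  set F : unitInterval → ℂ → Matrix (Fin (n + 1)) (Fin (n + 1)) ℂ := fun t x =>
    solutionValue (Γ t) * localSolution n (γ t) x with hF
  have hFs : ∀ t, ∀ x ∈ disk (γ t), SolvesAt (F t) x := fun t x hx =>
    (solvesAt_localSolution n _ hx).mul_left _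
  have hFs' : ∀ t, ∀ᶠ x in 𝓝 (γ t : ℂ), SolvesAt (F t) x := fun t =>
    eventually_of_mem ((isOpen_disk _).mem_nhds (mem_disk_self _)) (hFs t)
  have hFv : ∀ t, F t (γ t) = solutionValue (Γ t) := fun t => by
    rw [hF]
    simp only [localSolution_self, mul_one]
  have hFc : ∀ t, ∀ᶠ s in 𝓝 t, F s =ᶠ[𝓝 (γ s : ℂ)] F t := fun t => by
    filter_upwards [eventually_solutionValue_eq hΓ t] with s hs
    rw [hγ, hγ] at hs
    exact SolvesAt.eventuallyEq (hFs' s)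
      (eventually_of_mem ((isOpen_disk _).mem_nhds hs.1) (hFs t)) ((hFv s).trans hs.2)
  have hF0 : F 0 =ᶠ[𝓝 (a : ℂ)] f := by
    have h := hFs' 0
    have hv := (hFv 0).trans h0
    rw [γ.source] at h hv
    exact SolvesAt.eventuallyEq h hf hv
  have hF1 : F 1 =ᶠ[𝓝 (b : ℂ)] g := by
    have h := hFs' 1
    have hv := (hFv 1).trans h1
    rw [γ.target] at h hv
    exact SolvesAt.eventuallyEq h hg hv
  intro i j
  exact ⟨fun t x => F t x i j, fun t => SolvesAt.analyticAt (hFs' t) i j,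
    fun t => (hFc t).mono fun s hs => hs.fun_comp (fun A => A i j),
    hF0.fun_comp (fun A => A i j), hF1.fun_comp (fun A => A i j)⟩

/-! ### The monodromy representation. -/

theorem eventually_solvesAt_mul_fundMatrix {n : ℕ} (C : Matrix (Fin (n + 1)) (Fin (n + 1)) ℂ) :
    ∀ᶠ x in 𝓝 (base : ℂ), SolvesAt (fun x => C * fundMatrix n x) x :=
  eventually_of_mem ball_mem_nhds_base fun _ hx => (solvesAt_fundMatrix n hx).mul_left C

/-- The point of the fiber over the base point with value `C Λ(1/2)`. -/
def baseLift {n : ℕ} (C : Matrix (Fin (n + 1)) (Fin (n + 1)) ℂ) :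
    (solutionCore n).proj ⁻¹' {base} :=
  ⟨⟨base, SolutionFiber.mk (C * fundMatrix n base)⟩, rfl⟩

theorem exists_eq_baseLift {n : ℕ} (e : (solutionCore n).proj ⁻¹' {base}) :
    ∃ C, e = baseLift C := by
  obtain ⟨⟨b, Y⟩, h⟩ := e
  obtain rfl : b = base := h
  refine ⟨SolutionFiber.val Y * (fundMatrix n base)⁻¹, Subtype.ext ?_⟩
  refine congrArg (Bundle.TotalSpace.mk base) (SolutionFiber.ext ?_)
  exact (Matrix.nonsing_inv_mul_cancel_right _ _
    ((Matrix.isUnit_iff_isUnit_det _).mp (isUnit_fundMatrix n base))).symm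

theorem baseLift_injective (n : ℕ) : Function.Injective (baseLift (n := n)) := fun _ _ h =>
  (isUnit_fundMatrix n base).mul_right_cancel
    (congrArg (fun e : (solutionCore n).proj ⁻¹' {base} => solutionValue e.1) h)

/-- The matrix by which `Λ` is multiplied along a class of loops. -/
def monodromyMatrix (n : ℕ) (p : Path.Homotopic.Quotient base base) :
    Matrix (Fin (n + 1)) (Fin (n + 1)) ℂ :=
  (exists_eq_baseLift ((isCoveringMap_solutionCore n).monodromy p (baseLift 1))).choose

theorem monodromy_baseLift_one (n : ℕ) (p : Path.Homotopic.Quotient base base) :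
    (isCoveringMap_solutionCore n).monodromy p (baseLift 1) = baseLift (monodromyMatrix n p) :=
  (exists_eq_baseLift ((isCoveringMap_solutionCore n).monodromy p (baseLift 1))).choose_spec

theorem isMatrixContinuation_of_monodromy {n : ℕ} {γ : Path base base}
    {A B : Matrix (Fin (n + 1)) (Fin (n + 1)) ℂ}
    (h : (isCoveringMap_solutionCore n).monodromy (.mk γ) (baseLift A) = baseLift B) :
    IsMatrixContinuation (fun x => A * fundMatrix n x) γ (fun x => B * fundMatrix n x) := by
  have hs : γ 0 = (solutionCore n).proj (baseLift A).1 := γ.source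
  refine isMatrixContinuation_of_lift (eventually_solvesAt_mul_fundMatrix A)
    (eventually_solvesAt_mul_fundMatrix B)
    (Γ := (isCoveringMap_solutionCore n).liftPath γ (baseLift A).1 hs) (ContinuousMap.continuous _)
    (congrFun ((isCoveringMap_solutionCore n).liftPath_lifts γ _ hs)) ?_ ?_
  · rw [IsCoveringMap.liftPath_zero]
    rfl
  · exact congrArg (fun e : (solutionCore n).proj ⁻¹' {base} => solutionValue e.1) h

theorem isMatrixContinuation_monodromyMatrix (n : ℕ) (γ : Path base base) :
    IsMatrixContinuation (fundMatrix n) γ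
      (fun x => monodromyMatrix n (.mk γ) * fundMatrix n x) := by
  simpa only [one_mul] using isMatrixContinuation_of_monodromy (monodromy_baseLift_one n (.mk γ))

/-- Continuation commutes with constant left factors. This is what makes successive loops multiply
their matrices in the order of travel. -/
theorem monodromy_baseLift (n : ℕ) (p : Path.Homotopic.Quotient base base)
    (A : Matrix (Fin (n + 1)) (Fin (n + 1)) ℂ) :
    (isCoveringMap_solutionCore n).monodromy p (baseLift A) =
      baseLift (A * monodromyMatrix n p) := by
  obtain ⟨γ, rfl⟩ := Path.Homotopic.Quotient.mk_surjective p
  obtain ⟨B, hB⟩ := exists_eq_baseLift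
    ((isCoveringMap_solutionCore n).monodromy (.mk γ) (baseLift A))
  rw [hB]
  congr 1
  refine (isUnit_fundMatrix n base).mul_right_cancel (Matrix.ext fun i j => ?_)
  have h := (isMatrixContinuation_monodromyMatrix n γ).mul_left A
  simp only [← mul_assoc] at h
  exact ((isMatrixContinuation_of_monodromy hB i j).unique (h i j) EventuallyEq.rfl).self_of_nhds

/-- The monodromy representation of `Λ`. -/
def monodromyHom (n : ℕ) :
    (FundamentalGroup PuncturedPlane base)ᵐᵒᵖ →* GL (Fin (n + 1)) ℂ :=
  -- The source is a group, so multiplicativity alone makes all the values invertible.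
  MonoidHom.toHomUnits
    { toFun := fun p => monodromyMatrix n p.unop.toPath
      map_one' := baseLift_injective n <| by
        rw [← monodromy_baseLift_one]
        exact congrFun (isCoveringMap_solutionCore n).monodromy_refl _
      -- In the opposite group `p` is traversed first: it leads to `M(p) Λ`, and `q` then yields
      -- `M(p) M(q) Λ`.
      map_mul' := fun p q => baseLift_injective n <| by
        rw [← monodromy_baseLift_one, ← monodromy_baseLift, ← monodromy_baseLift_one]
        exact (isCoveringMap_solutionCore n).monodromy_trans_apply _ _ _ }

theorem isMonodromyRepresentation_monodromyHom (n : ℕ) :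
    IsMonodromyRepresentation n (monodromyHom n) :=
  isMatrixContinuation_monodromyMatrix n

theorem IsMonodromyRepresentation.unique {n : ℕ}
    {M M' : (FundamentalGroup PuncturedPlane base)ᵐᵒᵖ →* GL (Fin (n + 1)) ℂ}
    (hM : IsMonodromyRepresentation n M) (hM' : IsMonodromyRepresentation n M') : M = M' := by
  refine MonoidHom.ext fun p => Units.ext ?_
  obtain ⟨γ, hγ⟩ := Path.Homotopic.Quotient.mk_surjective p.unop.toPath
  have hp : p = loopClass γ := MulOpposite.unop_injective hγ.symm
  rw [hp]
  exact eq_of_isMatrixContinuation (hM γ) (hM' γ)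

end Polylog

end

theorem proposition2 (n : ℕ) :
    (∃! M : (FundamentalGroup Polylog.PuncturedPlane Polylog.base)ᵐᵒᵖ →* GL (Fin (n + 1)) ℂ,
      Polylog.IsMonodromyRepresentation n M) ∧
    (∀ M : (FundamentalGroup Polylog.PuncturedPlane Polylog.base)ᵐᵒᵖ →* GL (Fin (n + 1)) ℂ,
      Polylog.IsMonodromyRepresentation n M →
        (M (Polylog.loopClass Polylog.sigma0) : Matrix (Fin (n + 1)) (Fin (n + 1)) ℂ)
            = Polylog.blockOne (NormedSpace.exp (Polylog.shift n)) ∧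
        (M (Polylog.loopClass Polylog.sigma1) : Matrix (Fin (n + 1)) (Fin (n + 1)) ℂ)
            = Polylog.unipotentOne n) ∧
    (∀ k : ℕ, 1 ≤ k →
      Polylog.IsAnalyticContinuation (Polylog.polylog k) Polylog.sigma1
        (fun x => Polylog.polylog k x
          - 2 * (Real.pi : ℂ) * Complex.I / ((k - 1).factorial : ℂ)
            * Complex.log x ^ (k - 1))) := by
  refine ⟨⟨Polylog.monodromyHom n, Polylog.isMonodromyRepresentation_monodromyHom n,
    fun M hM => hM.unique (Polylog.isMonodromyRepresentation_monodromyHom n)⟩,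
    fun M hM => ⟨?_, ?_⟩, fun k hk => ?_⟩
  · exact Polylog.eq_of_isMatrixContinuation (hM _) (Polylog.isMatrixContinuation_sigma0 n)
  · exact Polylog.eq_of_isMatrixContinuation (hM _) (Polylog.isMatrixContinuation_sigma1 n)
  · obtain ⟨m, rfl⟩ := Nat.exists_eq_add_of_le' hk
    exact Polylog.isAnalyticContinuation_polylog_sigma1 m
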